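/- **Setting.** Let $d>0$, let $V:\mathbb R\to\mathbb R$ be locally integrable with $V(x+d)=V(x)$ for all $x$, let $\Gamma_\pm,\mu_s\in\mathbb R$ and $\Gamma(x)=\Gamma_+\chi_{[0,\infty)}(x)+\Gamma_-\chi_{(-\infty,0)}(x)$. Let $\phi_s:\mathbb R\to\mathbb R$ be a $C^1$ solution of $\phi_s''+\mu_s\phi_s-V\phi_s+\Gamma\phi_s^3=0$ with $|\phi_s(x)|\le Ce^{-\alpha|x|}$ for some $C\in\mathbb R$, $\alpha>0$. (All differential equations are understood in the Carathéodory sense: the function, and for second-order equations also its derivative, is locally absolutely continuous and the equation holds almost everywhere.) For $\lambda\in\mathbb C$ put $\mu_\pm=\mu_s\pm i\lambda$ and consider the first-order spectral system for $v=(u_1,u_1',u_2,u_2')$, $$v'=A(x;\lambda)v,\qquad A=\begin{pmatrix}0&1&0&0\\ V-2\Gamma\phi_s^2-\mu_+&0&-\Gamma\phi_s^2&0\\0&0&0&1\\-\Gamma\phi_s^2&0&V-2\Gamma\phi_s^2-\mu_-&0\end{pmatrix}.$$ Let $\psi_{1,2}^{\mu_+}(x)=p_{1,2}^{\mu_+}(x)e^{\pm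 ik_+x}$ and $\psi_{1,2}^{\mu_-}(x)=p_{1,2}^{\mu_-}(x)e^{\pm ik_-x}$, with $\operatorname{Im}k_\pm>0$, $d$-periodic $p_{1,2}^{\mu_\pm}$ and $p_{1,2}^{\mu_\pm}(0)=1$, be Bloch waves of Hill's equations $-\psi''+V\psi=\mu_+\psi$ and $-\psi''+V\psi=\mu_-\psi$ respectively. Let $v_1^\pm,v_2^\pm$ be solutions of $v'=Av$ on $\mathbb R$ with $$v_1^-\sim(\psi_2^{\mu_+},(\psi_2^{\mu_+})',0,0)^T,\quad v_2^-\sim(0,0,\psi_2^{\mu_-},(\psi_2^{\mu_-})')^T\quad (x\to-\infty),$$ $$v_1^+\sim(\psi_1^{\mu_+},(\psi_1^{\mu_+})',0,0)^T,\quad v_2^+\sim(0,0,\psi_1^{\mu_-},(\psi_1^{\mu_-})')^T\quad (x\to+\infty),$$ where $v\sim w$ means $\|v-w\|=o(\|w\|)$. For those $\lambda$ for which such Bloch waves and solutions exist (the domain of definition), the Evans function is $$\mathcal E(\lambda)=\det\big(v_1^-(x_*;\lambda),v_2^-(x_*;\lambda),v_1^+(x_*;\lambda),v_2^+(x_*;\lambda)\big),\qquad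 x_*\in\mathbb R.$$ **Lemma.** The value $\mathcal E(\lambda)$ depends neither on $x_*$ nor on the choice of $k_\pm$, the Bloch waves and the solutions $v_{1,2}^\pm$; the domain of definition is invariant under complex conjugation; and $\mathcal E(\bar\lambda)=\overline{\mathcal E(\lambda)}$ for every $\lambda$ in it. -/

import Mathlib

open Filter Asymptotics MeasureTheory

noncomputable section

/-- The nonlinear coefficient `Γ₊ χ_{[0,∞)} + Γ₋ χ_{(-∞,0)}`. -/
def interfaceCoeff (Γp Γm : ℝ) (x : ℝ) : ℝ := if 0 ≤ x then Γp else Γm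

/-- Real, exponentially localized `C¹` solutions of `φ'' + μ φ - V φ + Γ φ³ = 0`. As `Γ` (and possibly
`V`) is discontinuous, the equation is read in the Carathéodory sense: `φ'` is locally absolutely
continuous and the equation holds almost everywhere, that is, it holds after one integration. -/
structure IsGapSoliton (V : ℝ → ℝ) (Γp Γm μs : ℝ) (φ : ℝ → ℝ) : Prop where
  contDiff : ContDiff ℝ 1 φ
  eqn : ∀ x, deriv φ x = deriv φ 0 +
    ∫ t in (0 : ℝ)..x, (V t * φ t - μs * φ t - interfaceCoeff Γp Γm t * φ t ^ 3)
  localized : ∃ C α : ℝ, 0 < α ∧ ∀ x, |φ x| ≤ C * Real.exp (-α * |x|)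

/-- `C¹` solutions of Hill's equation `-ψ'' + V ψ = μ ψ`, in the Carathéodory sense. -/
structure IsHillSolution (V : ℝ → ℝ) (μ : ℂ) (ψ : ℝ → ℂ) : Prop where
  contDiff : ContDiff ℝ 1 ψ
  eqn : ∀ x, deriv ψ x = deriv ψ 0 + ∫ t in (0 : ℝ)..x, ((V t : ℂ) - μ) * ψ t

/-- `ψ` is the Bloch wave `ψ(x) = p(x) e^{ikx}` of Hill's equation, `p` being `d`-periodic and
normalized by `p(0) = 1`. -/
structure IsBlochWave (V : ℝ → ℝ) (d : ℝ) (μ k : ℂ) (ψ : ℝ → ℂ) : Prop where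
  hill : IsHillSolution V μ ψ
  bloch : ∃ p : ℝ → ℂ, Function.Periodic p d ∧ p 0 = 1 ∧
    ∀ x, ψ x = p x * Complex.exp (Complex.I * k * x)

/-- The coefficient matrix of the first-order spectral system for `(u₁, u₁', u₂, u₂')`,
with `μ_± = μ_s ± iλ`. -/
def spectralMatrix (V : ℝ → ℝ) (Γp Γm μs : ℝ) (φ : ℝ → ℝ) (lam : ℂ) (x : ℝ) :
    Matrix (Fin 4) (Fin 4) ℂ :=
  let g : ℂ := ((interfaceCoeff Γp Γm x * φ x ^ 2 : ℝ) : ℂ)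
  !![0, 1, 0, 0;
     (V x : ℂ) - 2 * g - (μs + Complex.I * lam), 0, -g, 0;
     0, 0, 0, 1;
     -g, 0, (V x : ℂ) - 2 * g - (μs - Complex.I * lam), 0]

/-- Carathéodory solutions on `ℝ` of the linear system `v' = A v`. -/
structure IsSystemSolution (A : ℝ → Matrix (Fin 4) (Fin 4) ℂ) (v : ℝ → Fin 4 → ℂ) : Prop where
  continuous : Continuous v
  eqn : ∀ x, v x = v 0 + ∫ t in (0 : ℝ)..x, (A t).mulVec (v t)

/-- The solutions `v₁⁻, v₂⁻, v₁⁺, v₂⁺` of the spectral system at `λ` that enter the Evans function,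
with the normalized Bloch waves `ψ_{1,2}^{μ_+}` and `ψ_{1,2}^{μ_-}` to which they are asymptotic.
The relation `v ~[l] w` means `‖v - w‖ = o(‖w‖)` along `l`. -/
structure EvansFrame (V : ℝ → ℝ) (d Γp Γm μs : ℝ) (φ : ℝ → ℝ) (lam : ℂ) where
  (kp km : ℂ)
  (ψp₁ ψp₂ ψm₁ ψm₂ : ℝ → ℂ)
  (vm₁ vm₂ vp₁ vp₂ : ℝ → Fin 4 → ℂ)
  kp_im_pos : 0 < kp.im
  km_im_pos : 0 < km.im
  bloch_p₁ : IsBlochWave V d (μs + Complex.I * lam) kp ψp₁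
  bloch_p₂ : IsBlochWave V d (μs + Complex.I * lam) (-kp) ψp₂
  bloch_m₁ : IsBlochWave V d (μs - Complex.I * lam) km ψm₁
  bloch_m₂ : IsBlochWave V d (μs - Complex.I * lam) (-km) ψm₂
  sol_vm₁ : IsSystemSolution (spectralMatrix V Γp Γm μs φ lam) vm₁
  sol_vm₂ : IsSystemSolution (spectralMatrix V Γp Γm μs φ lam) vm₂
  sol_vp₁ : IsSystemSolution (spectralMatrix V Γp Γm μs φ lam) vp₁
  sol_vp₂ : IsSystemSolution (spectralMatrix V Γp Γm μs φ lam) vp₂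
  asymp_vm₁ : vm₁ ~[atBot] fun x => ![ψp₂ x, deriv ψp₂ x, 0, 0]
  asymp_vm₂ : vm₂ ~[atBot] fun x => ![0, 0, ψm₂ x, deriv ψm₂ x]
  asymp_vp₁ : vp₁ ~[atTop] fun x => ![ψp₁ x, deriv ψp₁ x, 0, 0]
  asymp_vp₂ : vp₂ ~[atTop] fun x => ![0, 0, ψm₁ x, deriv ψm₁ x]

/-- The determinant with columns `v₁⁻(x), v₂⁻(x), v₁⁺(x), v₂⁺(x)`. -/
def EvansFrame.det {V : ℝ → ℝ} {d Γp Γm μs : ℝ} {φ : ℝ → ℝ} {lam : ℂ}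
    (F : EvansFrame V d Γp Γm μs φ lam) (x : ℝ) : ℂ :=
  Matrix.det (Matrix.of ![F.vm₁ x, F.vm₂ x, F.vp₁ x, F.vp₂ x]).transpose

open scoped Classical in
/-- The Evans function, evaluated at the matching point `xs`. Outside its domain of definition,
where the normalized exponentially decaying Bloch waves do not exist, it is given the value `0`. -/
def evansFunction (V : ℝ → ℝ) (d Γp Γm μs : ℝ) (φ : ℝ → ℝ) (xs : ℝ) (lam : ℂ) : ℂ :=
  if h : Nonempty (EvansFrame V d Γp Γm μs φ lam) then h.some.det xs else 0

end

open Set Topology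

/-! ### Absolute continuity of vector-valued primitives. -/

section AbsolutelyContinuous


/-! The spectral matrix is infinitesimally symplectic, so `wronskian` is constant along pairs of
solutions, and zero if both decay at the same end. The determinant of four vectors is the Pfaffian
of their pairwise Wronskians (`det_eq_wronskian`), hence independent of the matching point.

For the choices: a decaying normalized Bloch wave is unique, because two decaying Hill solutions
have zero Wronskian. At each end the decaying solutions are pairwise isotropic, so two admissible
pairs there differ by a 2 × 2 matrix. The asymptotics force its diagonal to be 1, while its
off-diagonal entries `a`, `b` satisfy `a s/t → 0` and `b t/s → 0` for the Bloch values `s`, `t`.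
Neither entry need vanish a priori, but `a * b = 0`, so the matrix has determinant 1
(`IsSystemSolution.exists_eq_combination_det_one`) and the Evans determinant is unchanged.

For the symmetry: complex conjugation with exchange of the two components carries frames at `λ` to
frames at its conjugate. It swaps the columns within both pairs, and the two signs cancel. -/

theorem absolutelyContinuousOnInterval_of_dist_le {X Y : Type*} [PseudoMetricSpace X]
    [PseudoMetricSpace Y] {f : ℝ → X} {g : ℝ → Y} {a b : ℝ}
    (hg : AbsolutelyContinuousOnInterval g a b) (h : ∀ x y, dist (f x) (f y) ≤ dist (g x) (g y)) :
    AbsolutelyContinuousOnInterval f a b :=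
  squeeze_zero (fun _ => Finset.sum_nonneg fun _ _ => dist_nonneg)
    (fun _ => Finset.sum_le_sum fun _ _ => h _ _) hg

theorem MeasureTheory.LocallyIntegrable.intervalIntegrable {E : Type*} [NormedAddCommGroup E]
    {f : ℝ → E}
    (hf : LocallyIntegrable f volume) (a b : ℝ) : IntervalIntegrable f volume a b :=
  (hf.integrableOn_isCompact isCompact_uIcc).intervalIntegrable

theorem MeasureTheory.LocallyIntegrable.absolutelyContinuousOnInterval_integral
    {E : Type*} [NormedAddCommGroup E] [NormedSpace ℝ E] {f : ℝ → E} (hf : LocallyIntegrable f volume) (a b : ℝ) :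
    AbsolutelyContinuousOnInterval (fun x => ∫ t in (0 : ℝ)..x, f t) a b := by
  have hn : LocallyIntegrable (fun t => ‖f t‖) volume :=
    hf.mono hf.aestronglyMeasurable.norm (by simp)
  have hle : min (min a b) 0 ≤ max (max a b) 0 := (min_le_right _ _).trans (le_max_right _ _)
  -- The interval is enlarged to contain the base point 0; the scalar primitive of the norm then
  -- controls the increments.
  have key := ((hn.intervalIntegrable (min (min a b) 0)
    (max (max a b) 0)).absolutelyContinuousOnInterval_intervalIntegral (c := 0) (by
      rw [uIcc_of_le hle]; simp)).mono (c := a) (d := b) (by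
      rw [uIcc_of_le hle]
      exact uIcc_subset_Icc ⟨by simp, by simp⟩ ⟨by simp, by simp⟩)
  refine absolutelyContinuousOnInterval_of_dist_le key fun x y => ?_
  rw [dist_eq_norm, dist_eq_norm,
    intervalIntegral.integral_interval_sub_left (hf.intervalIntegrable _ _)
      (hf.intervalIntegrable _ _),
    intervalIntegral.integral_interval_sub_left (hn.intervalIntegrable _ _)
      (hn.intervalIntegrable _ _)]
  exact intervalIntegral.norm_integral_le_abs_integral_norm

end AbsolutelyContinuous

/-! ### Symplectic linear algebra in `ℂ⁴`. -/

/-- The bilinear symplectic form on `ℂ⁴` preserved by the spectral system. -/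
def wronskian (v w : Fin 4 → ℂ) : ℂ := v 0 * w 1 - v 1 * w 0 + v 2 * w 3 - v 3 * w 2

theorem det_eq_wronskian (a b c e : Fin 4 → ℂ) :
    Matrix.det (Matrix.of ![a, b, c, e]).transpose =
      wronskian a b * wronskian c e - wronskian a c * wronskian b e
        + wronskian a e * wronskian b c := by
  rw [Matrix.det_transpose]
  simp [Matrix.det_succ_row_zero, Fin.sum_univ_succ, wronskian, Fin.succAbove]
  ring

/-- An isotropic plane in dimension four is its own symplectic complement. The nonzero minor lets
`a` and `b` be read off from components 0 and 2. -/
theorem exists_eq_combination_of_wronskian {v w z : Fin 4 → ℂ} (hvw : wronskian v w = 0)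
    (hvz : wronskian v z = 0) (hwz : wronskian w z = 0) (h : v 0 * w 2 - v 2 * w 0 ≠ 0) :
    ∃ a b : ℂ, z = a • v + b • w := by
  set D := v 0 * w 2 - v 2 * w 0 with hD
  obtain ⟨a, ha⟩ : ∃ a, a * D = z 0 * w 2 - z 2 * w 0 := ⟨_, div_mul_cancel₀ _ h⟩
  obtain ⟨b, hb⟩ : ∃ b, b * D = v 0 * z 2 - v 2 * z 0 := ⟨_, div_mul_cancel₀ _ h⟩
  have h0 : z 0 - a * v 0 - b * w 0 = 0 := by
    refine (mul_eq_zero.1 ?_).resolve_right h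
    linear_combination (-v 0) * ha - w 0 * hb + z 0 * hD
  have h2 : z 2 - a * v 2 - b * w 2 = 0 := by
    refine (mul_eq_zero.1 ?_).resolve_right h
    linear_combination (-v 2) * ha - w 2 * hb + z 2 * hD
  simp only [wronskian] at hvw hvz hwz
  -- The remainder has only components 1 and 3; orthogonality to `v` and `w` is a linear system for
  -- them with determinant `D`.
  have e1 : v 0 * (z 1 - a * v 1 - b * w 1) + v 2 * (z 3 - a * v 3 - b * w 3) = 0 := by
    linear_combination hvz - b * hvw + v 1 * h0 + v 3 * h2
  have e2 : w 0 * (z 1 - a * v 1 - b * w 1) + w 2 * (z 3 - a * v 3 - b * w 3) = 0 := by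
    linear_combination hwz + a * hvw + w 1 * h0 + w 3 * h2
  have h1 : z 1 - a * v 1 - b * w 1 = 0 := by
    refine (mul_eq_zero.1 ?_).resolve_right h
    linear_combination w 2 * e1 - v 2 * e2 + (z 1 - a * v 1 - b * w 1) * hD
  have h3 : z 3 - a * v 3 - b * w 3 = 0 := by
    refine (mul_eq_zero.1 ?_).resolve_right h
    linear_combination v 0 * e2 - w 0 * e1 + (z 3 - a * v 3 - b * w 3) * hD
  refine ⟨a, b, ?_⟩
  ext i
  fin_cases i <;> simp
  · linear_combination h0
  · linear_combination h1
  · linear_combination h2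
  · linear_combination h3

theorem tendsto_wronskian {ι : Type*} {l : Filter ι} {v w : ι → Fin 4 → ℂ} {a b : Fin 4 → ℂ}
    (hv : Tendsto v l (𝓝 a)) (hw : Tendsto w l (𝓝 b)) :
    Tendsto (fun x => wronskian (v x) (w x)) l (𝓝 (wronskian a b)) := by
  rw [tendsto_pi_nhds] at hv hw
  exact ((((hv 0).mul (hw 1)).sub ((hv 1).mul (hw 0))).add ((hv 2).mul (hw 3))).sub
    ((hv 3).mul (hw 2))

/-! ### Carathéodory systems with an invariant symplectic form. -/

section System

variable {A : ℝ → Matrix (Fin 4) (Fin 4) ℂ}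

theorem locallyIntegrable_mulVec (hA : ∀ i j, LocallyIntegrable (fun t => A t i j) volume)
    {v : ℝ → Fin 4 → ℂ} (hv : Continuous v) :
    LocallyIntegrable (fun t => (A t).mulVec (v t)) volume := by
  rw [locallyIntegrable_iff]
  refine fun K hK => Integrable.of_eval fun i => ?_
  simp only [Matrix.mulVec, dotProduct]
  exact integrable_finsetSum _ fun j _ =>
    ((hA i j).integrableOn_isCompact hK).mul_continuousOn
      ((continuous_apply j).comp hv).continuousOn hK

namespace IsSystemSolution

variable {v w : ℝ → Fin 4 → ℂ}

theorem ae_hasDerivAt (hA : ∀ i j, LocallyIntegrable (fun t => A t i j) volume)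
    (hv : IsSystemSolution A v) : ∀ᵐ x, HasDerivAt v ((A x).mulVec (v x)) x := by
  filter_upwards [LocallyIntegrable.ae_hasDerivAt_integral
    (locallyIntegrable_mulVec hA hv.continuous)] with x hx
  exact ((hx 0).const_add (v 0)).congr_of_eventuallyEq (Eventually.of_forall hv.eqn)

theorem absolutelyContinuousOnInterval (hA : ∀ i j, LocallyIntegrable (fun t => A t i j) volume)
    (hv : IsSystemSolution A v) (a b : ℝ) (i : Fin 4) :
    AbsolutelyContinuousOnInterval (fun x => v x i) a b := by
  refine absolutelyContinuousOnInterval_of_dist_le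
    ((locallyIntegrable_mulVec hA hv.continuous).absolutelyContinuousOnInterval_integral a b)
    fun x y => (dist_le_pi_dist (v x) (v y) i).trans_eq ?_
  rw [hv.eqn x, hv.eqn y, dist_add_left]

theorem wronskian_eq (hA : ∀ i j, LocallyIntegrable (fun t => A t i j) volume)
    (hsymm : ∀ x a b, wronskian ((A x).mulVec a) b + wronskian a ((A x).mulVec b) = 0)
    (hv : IsSystemSolution A v) (hw : IsSystemSolution A w) (x y : ℝ) :
    wronskian (v x) (w x) = wronskian (v y) (w y) := by
  have hac : AbsolutelyContinuousOnInterval (fun t => wronskian (v t) (w t)) x y := by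
    have hv' := hv.absolutelyContinuousOnInterval hA x y
    have hw' := hw.absolutelyContinuousOnInterval hA x y
    exact ((((hv' 0).fun_smul (hw' 1)).fun_sub ((hv' 1).fun_smul (hw' 0))).fun_add
      ((hv' 2).fun_smul (hw' 3))).fun_sub ((hv' 3).fun_smul (hw' 2))
  obtain ⟨C, hC⟩ := hac.const_of_ae_hasDerivAt_zero (by
    filter_upwards [hv.ae_hasDerivAt hA, hw.ae_hasDerivAt hA] with t hvt hwt _
    rw [hasDerivAt_pi] at hvt hwt
    have := ((((hvt 0).mul (hwt 1)).sub ((hvt 1).mul (hwt 0))).add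
      ((hvt 2).mul (hwt 3))).sub ((hvt 3).mul (hwt 2))
    refine this.congr_deriv ?_
    rw [← hsymm t (v t) (w t)]
    simp only [wronskian]
    ring)
  rw [hC x (by simp), hC y (by simp)]

theorem wronskian_eq_zero (hA : ∀ i j, LocallyIntegrable (fun t => A t i j) volume)
    (hsymm : ∀ x a b, wronskian ((A x).mulVec a) b + wronskian a ((A x).mulVec b) = 0)
    {l : Filter ℝ} [l.NeBot] (hv : IsSystemSolution A v) (hw : IsSystemSolution A w)
    (hv0 : Tendsto v l (𝓝 0)) (hw0 : Tendsto w l (𝓝 0)) (x : ℝ) :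
    wronskian (v x) (w x) = 0 := by
  have h := tendsto_wronskian hv0 hw0
  simp only [fun y => wronskian_eq hA hsymm hv hw y x] at h
  simpa [wronskian] using tendsto_nhds_unique tendsto_const_nhds h

theorem add (hA : ∀ i j, LocallyIntegrable (fun t => A t i j) volume)
    (hv : IsSystemSolution A v) (hw : IsSystemSolution A w) :
    IsSystemSolution A (fun x => v x + w x) := by
  refine ⟨hv.continuous.add hw.continuous, fun x => ?_⟩
  simp only [Matrix.mulVec_add]
  rw [intervalIntegral.integral_add
    ((locallyIntegrable_mulVec hA hv.continuous).intervalIntegrable _ _)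
    ((locallyIntegrable_mulVec hA hw.continuous).intervalIntegrable _ _), hv.eqn x, hw.eqn x]
  abel

theorem const_smul (c : ℂ) (hv : IsSystemSolution A v) :
    IsSystemSolution A (fun x => c • v x) := by
  refine ⟨hv.continuous.const_smul c, fun x => ?_⟩
  simp only [Matrix.mulVec_smul]
  rw [intervalIntegral.integral_smul, ← smul_add, ← hv.eqn x]

/-- The zero set is closed by continuity and open by a contraction estimate on short intervals,
hence all of `ℝ`. -/
theorem eq_zero (hA : ∀ i j, LocallyIntegrable (fun t => A t i j) volume)
    (hv : IsSystemSolution A v) {x₀ : ℝ} (h₀ : v x₀ = 0) (x : ℝ) : v x = 0 := by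
  set m : ℝ → ℝ := fun t => ∑ i, ∑ j, ‖A t i j‖ with hm
  have hm0 : ∀ t, 0 ≤ m t := fun t => by positivity
  have hmint : LocallyIntegrable m volume := by
    rw [locallyIntegrable_iff]
    exact fun K hK => integrable_finsetSum _ fun i _ => integrable_finsetSum _ fun j _ =>
      ((hA i j).integrableOn_isCompact hK).norm
  have hbound : ∀ t, ‖(A t).mulVec (v t)‖ ≤ m t * ‖v t‖ := fun t => by
    rw [pi_norm_le_iff_of_nonneg (by positivity)]
    intro i
    calc ‖(A t).mulVec (v t) i‖ = ‖∑ j, A t i j * v t j‖ := rfl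
      _ ≤ ∑ j, ‖A t i j * v t j‖ := norm_sum_le _ _
      _ ≤ ∑ j, ‖A t i j‖ * ‖v t‖ := by
          gcongr with j
          rw [norm_mul]
          gcongr
          exact norm_le_pi_norm _ _
      _ = (∑ j, ‖A t i j‖) * ‖v t‖ := by rw [Finset.sum_mul]
      _ ≤ m t * ‖v t‖ := by
          gcongr
          exact Finset.single_le_sum (f := fun i => ∑ j, ‖A t i j‖)
            (fun i _ => by positivity) (Finset.mem_univ i)
  have hsub : ∀ y z, v z = v y + ∫ t in y..z, (A t).mulVec (v t) := fun y z => by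
    rw [hv.eqn z, hv.eqn y, add_assoc, intervalIntegral.integral_add_adjacent_intervals] <;>
      exact (locallyIntegrable_mulVec hA hv.continuous).intervalIntegrable _ _
  have hopen : IsOpen {y | v y = 0} := by
    rw [isOpen_iff_mem_nhds]
    intro y hy
    have hcont : Continuous fun z => ∫ t in y..z, m t :=
      intervalIntegral.continuous_primitive (fun a b => hmint.intervalIntegrable a b) y
    have hev : ∀ᶠ z in 𝓝 y, |∫ t in y..z, m t| < 1 / 2 := by
      have := (hcont.abs.tendsto y)
      simp only [intervalIntegral.integral_same, abs_zero] at this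
      exact this.eventually_lt_const (by norm_num)
    obtain ⟨δ, hδ, hball⟩ := Metric.eventually_nhds_iff_ball.1 hev
    refine mem_of_superset (Metric.closedBall_mem_nhds y (half_pos hδ)) ?_
    obtain ⟨z₀, hz₀, hmax⟩ := (isCompact_closedBall y (δ / 2)).exists_isMaxOn
      ⟨y, Metric.mem_closedBall_self (by positivity)⟩ hv.continuous.norm.continuousOn
    have hz₀0 : ‖v z₀‖ = 0 := by
      have h1 : ‖v z₀‖ ≤ |∫ t in y..z₀, m t * ‖v z₀‖| := by
        nth_rewrite 1 [hsub y z₀]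
        rw [show v y = 0 from hy, zero_add]
        refine intervalIntegral.norm_integral_le_abs_of_norm_le
          ((ae_restrict_iff' measurableSet_uIoc).2 (Eventually.of_forall fun t ht => ?_))
          ((hmint.intervalIntegrable _ _).mul_const _)
        refine (hbound t).trans (mul_le_mul_of_nonneg_left (hmax ?_) (hm0 t))
        exact (convex_closedBall y (δ / 2)).ordConnected.uIcc_subset
          (Metric.mem_closedBall_self (by positivity)) hz₀ (uIoc_subset_uIcc ht)
      rw [intervalIntegral.integral_mul_const, abs_mul, abs_norm] at h1
      have h2 := hball z₀ (Metric.closedBall_subset_ball (by linarith) hz₀)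
      -- The maximum of the norm is at most half of itself.
      nlinarith [norm_nonneg (v z₀)]
    intro z hz
    have := hmax hz
    exact norm_le_zero_iff.1 (hz₀0 ▸ this)
  have hclosed : IsClosed {y | v y = 0} := isClosed_eq hv.continuous continuous_const
  exact eq_univ_iff_forall.1 (IsClopen.eq_univ ⟨hclosed, hopen⟩ ⟨x₀, h₀⟩) x

end IsSystemSolution

end System

/-! ### Regularity and symplectic structure of the spectral matrix. -/

theorem measurable_interfaceCoeff (Γp Γm : ℝ) : Measurable (interfaceCoeff Γp Γm) :=
  Measurable.ite measurableSet_Ici measurable_const measurable_const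

theorem locallyIntegrable_interfaceCoeff (Γp Γm : ℝ) :
    LocallyIntegrable (interfaceCoeff Γp Γm) volume := by
  refine (locallyIntegrable_const (|Γp| + |Γm|)).mono
    (measurable_interfaceCoeff Γp Γm).aestronglyMeasurable (Eventually.of_forall fun x => ?_)
  rw [Real.norm_eq_abs, Real.norm_eq_abs, abs_of_nonneg (a := |Γp| + |Γm|) (by positivity),
    interfaceCoeff]
  split_ifs <;> simp

theorem MeasureTheory.LocallyIntegrable.ofReal {f : ℝ → ℝ} (hf : LocallyIntegrable f volume) :
    LocallyIntegrable (fun x => (f x : ℂ)) volume :=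
  hf.mono (Complex.continuous_ofReal.comp_aestronglyMeasurable hf.aestronglyMeasurable) (by simp)

section Spectral

variable {V : ℝ → ℝ} {Γp Γm μs : ℝ} {φ : ℝ → ℝ} {lam : ℂ}

theorem locallyIntegrable_spectralMatrix (hV : LocallyIntegrable V volume) (hφ : Continuous φ)
    (Γp Γm μs : ℝ) (lam : ℂ) (i j : Fin 4) :
    LocallyIntegrable (fun x => spectralMatrix V Γp Γm μs φ lam x i j) volume := by
  have hg : LocallyIntegrable
      (fun x => ((interfaceCoeff Γp Γm x * φ x ^ 2 : ℝ) : ℂ)) volume := by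
    refine LocallyIntegrable.ofReal ?_
    rw [locallyIntegrable_iff]
    exact fun K hK => ((locallyIntegrable_interfaceCoeff Γp Γm).integrableOn_isCompact
      hK).mul_continuousOn (hφ.pow 2).continuousOn hK
  have hV' := hV.ofReal
  have hc : ∀ c : ℂ, LocallyIntegrable (fun _ : ℝ => c) volume := locallyIntegrable_const
  have hgen : ∀ c : ℂ, LocallyIntegrable
      (fun x => (V x : ℂ) - 2 * ((interfaceCoeff Γp Γm x * φ x ^ 2 : ℝ) : ℂ) - c) volume :=
    fun c => (hV'.sub (hg.smul (2 : ℂ))).sub (hc c)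
  fin_cases i <;> fin_cases j
  all_goals first | exact hc 0 | exact hc 1 | exact hg.neg | exact hgen _

/-- The two coupling entries are equal, so the potential block acting on components 0 and 2 is
symmetric. -/
theorem wronskian_spectralMatrix (x : ℝ) (a b : Fin 4 → ℂ) :
    wronskian ((spectralMatrix V Γp Γm μs φ lam x).mulVec a) b +
      wronskian a ((spectralMatrix V Γp Γm μs φ lam x).mulVec b) = 0 := by
  simp [spectralMatrix, wronskian, Matrix.mulVec, dotProduct, Fin.sum_univ_four]
  ring

end Spectral

/-! ### Bloch waves: decay, uniqueness and sampling. -/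

section Bloch

variable {V : ℝ → ℝ} {d : ℝ} {μ k : ℂ} {ψ : ℝ → ℂ}

/-- Without coupling and with `λ = -iμ`, `μs = 0`, the first block is Hill's equation at `μ`;
results on the 4 × 4 system thus apply to it. -/
theorem IsHillSolution.isSystemSolution (hV : LocallyIntegrable V volume)
    (hψ : IsHillSolution V μ ψ) :
    IsSystemSolution (spectralMatrix V 0 0 0 0 (-Complex.I * μ))
      (fun x => ![ψ x, deriv ψ x, 0, 0]) := by
  have hc : Continuous fun x => ![ψ x, deriv ψ x, 0, 0] := by
    rw [continuous_pi_iff]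
    intro i
    fin_cases i
    exacts [hψ.contDiff.continuous, hψ.contDiff.continuous_deriv_one, continuous_const,
      continuous_const]
  have hA := locallyIntegrable_spectralMatrix hV (φ := 0) continuous_const 0 0 0 (-Complex.I * μ)
  refine ⟨hc, fun x => ?_⟩
  have hint := (locallyIntegrable_mulVec hA hc).intervalIntegrable 0 x
  ext i
  rw [Pi.add_apply, ← ContinuousLinearMap.proj_apply (R := ℂ) i (∫ t in (0 : ℝ)..x, _),
    ← ContinuousLinearMap.intervalIntegral_comp_comm _ hint]
  fin_cases i
  · simp [spectralMatrix]
    rw [intervalIntegral.integral_deriv_eq_sub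
      (fun y _ => (hψ.contDiff.differentiable (by norm_num)).differentiableAt)
      (hψ.contDiff.continuous_deriv_one.intervalIntegrable _ _)]
    ring
  · have := hψ.eqn x
    simp only [mul_comm _ (ψ _)] at this
    simpa [spectralMatrix, ← mul_assoc] using this
  · simp [spectralMatrix]
  · simp [spectralMatrix, interfaceCoeff]

theorem IsHillSolution.eq_of_tendsto_zero (hV : LocallyIntegrable V volume) {ψ' : ℝ → ℂ}
    {l : Filter ℝ} [l.NeBot] (hψ : IsHillSolution V μ ψ) (hψ' : IsHillSolution V μ ψ')
    (h0 : ψ 0 = 1) (h0' : ψ' 0 = 1)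
    (hl : Tendsto (fun x => ![ψ x, deriv ψ x, 0, 0]) l (𝓝 0))
    (hl' : Tendsto (fun x => ![ψ' x, deriv ψ' x, 0, 0]) l (𝓝 0)) : ψ = ψ' := by
  have hA := locallyIntegrable_spectralMatrix hV (φ := 0) continuous_const 0 0 0 (-Complex.I * μ)
  have hs := hψ.isSystemSolution hV
  have hs' := hψ'.isSystemSolution hV
  have hw := hs.wronskian_eq_zero hA wronskian_spectralMatrix hs' hl hl' 0
  simp only [wronskian, h0, h0'] at hw
  simp at hw
  -- With both values at 0 equal to 1, the vanishing Wronskian says that the derivatives at 0 agree.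
  have := (hs.add hA (hs'.const_smul (-1))).eq_zero hA (x₀ := 0) (by
    ext i
    fin_cases i <;> simp [h0, h0']
    linear_combination -hw)
  ext x
  have := congrFun (this x) 0
  simp at this
  linear_combination this

theorem IsBlochWave.zero_eq (h : IsBlochWave V d μ k ψ) : ψ 0 = 1 := by
  obtain ⟨p, -, hp0, hp⟩ := h.bloch
  simp [hp, hp0]

theorem IsBlochWave.add_int_mul (h : IsBlochWave V d μ k ψ) (n : ℤ) (x : ℝ) :
    ψ (x + n * d) = Complex.exp (Complex.I * k * (n * d : ℝ)) * ψ x := by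
  obtain ⟨p, hper, -, hp⟩ := h.bloch
  rw [hp, hp, hper.int_mul n x]
  push_cast
  rw [mul_add, Complex.exp_add]
  ring

theorem IsBlochWave.deriv_add_int_mul (h : IsBlochWave V d μ k ψ) (n : ℤ) (x : ℝ) :
    deriv ψ (x + n * d) = Complex.exp (Complex.I * k * (n * d : ℝ)) * deriv ψ x := by
  rw [← deriv_comp_add_const, funext (h.add_int_mul n), deriv_const_mul_field]

/-- Removing the exponential leaves a continuous periodic, hence bounded, factor. This serves `ψ`
and its derivative alike, as they share the Floquet multiplier. -/
theorem tendsto_zero_of_quasiperiodic {f : ℝ → ℂ} (hd : d ≠ 0) (hf : Continuous f)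
    (hper : ∀ x, f (x + d) = Complex.exp (Complex.I * k * d) * f x) {l : Filter ℝ}
    (hl : Tendsto (fun x => k.im * x) l atTop) : Tendsto f l (𝓝 0) := by
  set q : ℝ → ℂ := fun x => Complex.exp (-(Complex.I * k * x)) * f x with hq
  have hqper : Function.Periodic q d := fun x => by
    simp only [hq, hper]
    rw [← mul_assoc, ← Complex.exp_add]
    congr 2
    push_cast
    ring
  obtain ⟨C, hC⟩ := (hqper.isBounded_of_continuous hd (by fun_prop)).exists_norm_le
  have hfq : ∀ x, ‖f x‖ ≤ Real.exp (-(k.im * x)) * C := fun x => by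
    have : f x = Complex.exp (Complex.I * k * x) * q x := by
      simp only [hq]
      rw [← mul_assoc, ← Complex.exp_add, add_neg_cancel, Complex.exp_zero, one_mul]
    rw [this, norm_mul, Complex.norm_exp]
    have hre : (Complex.I * k * x).re = -(k.im * x) := by simp
    rw [hre]
    gcongr
    exact hC _ (mem_range_self x)
  refine squeeze_zero_norm hfq ?_
  simpa using ((Real.tendsto_exp_neg_atTop_nhds_zero.comp hl).mul_const C)

theorem IsBlochWave.tendsto_zero (hd : d ≠ 0) (h : IsBlochWave V d μ k ψ) {l : Filter ℝ}
    (hl : Tendsto (fun x => k.im * x) l atTop) : Tendsto ψ l (𝓝 0) :=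
  tendsto_zero_of_quasiperiodic hd h.hill.contDiff.continuous
    (fun x => by simpa using h.add_int_mul 1 x) hl

theorem IsBlochWave.tendsto_deriv_zero (hd : d ≠ 0) (h : IsBlochWave V d μ k ψ) {l : Filter ℝ}
    (hl : Tendsto (fun x => k.im * x) l atTop) : Tendsto (deriv ψ) l (𝓝 0) :=
  tendsto_zero_of_quasiperiodic hd h.hill.contDiff.continuous_deriv_one
    (fun x => by simpa using h.deriv_add_int_mul 1 x) hl

theorem tendsto_vec_zero {l : Filter ℝ} {a b c e : ℝ → ℂ} (ha : Tendsto a l (𝓝 0))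
    (hb : Tendsto b l (𝓝 0)) (hc : Tendsto c l (𝓝 0)) (he : Tendsto e l (𝓝 0)) :
    Tendsto (fun x => ![a x, b x, c x, e x]) l (𝓝 0) := by
  rw [tendsto_pi_nhds]
  intro i
  fin_cases i
  exacts [ha, hb, hc, he]

theorem IsBlochWave.unique (hV : LocallyIntegrable V volume) (hd : d ≠ 0) {k' : ℂ} {ψ' : ℝ → ℂ}
    (h : IsBlochWave V d μ k ψ) (h' : IsBlochWave V d μ k' ψ') {l : Filter ℝ} [l.NeBot]
    (hl : Tendsto (fun x => k.im * x) l atTop) (hl' : Tendsto (fun x => k'.im * x) l atTop) :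
    ψ = ψ' :=
  h.hill.eq_of_tendsto_zero hV h'.hill h.zero_eq h'.zero_eq
    (tendsto_vec_zero (h.tendsto_zero hd hl) (h.tendsto_deriv_zero hd hl)
      tendsto_const_nhds tendsto_const_nhds)
    (tendsto_vec_zero (h'.tendsto_zero hd hl') (h'.tendsto_deriv_zero hd hl')
      tendsto_const_nhds tendsto_const_nhds)

/-- Asymptotics are sampled at multiples of the period because the Bloch wave may vanish elsewhere.
-/
theorem IsBlochWave.ne_zero (h : IsBlochWave V d μ k ψ) (n : ℤ) : ψ (n * d) ≠ 0 := by
  have := h.add_int_mul n 0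
  rw [zero_add] at this
  simp [this, h.zero_eq]

/-- Along multiples of the period, a vector function asymptotic to a multiple of the phase-space
curve of a Bloch wave has, after division by the Bloch wave, the limit of the latter. -/
theorem IsBlochWave.tendsto_div (h : IsBlochWave V d μ k ψ) {l : Filter ℝ} {m : ℕ → ℤ}
    (hm : Tendsto (fun n => (m n * d : ℝ)) atTop l) {v : ℝ → Fin 4 → ℂ}
    (L : ℂ × ℂ →ₗ[ℂ] (Fin 4 → ℂ)) (hv : v ~[l] fun x => L (ψ x, deriv ψ x)) (i : Fin 4) :
    Tendsto (fun n => v (m n * d) i / ψ (m n * d)) atTop (𝓝 (L (1, deriv ψ 0) i)) := by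
  have hw : ∀ n : ℤ, L (ψ (n * d), deriv ψ (n * d)) = ψ (n * d) • L (1, deriv ψ 0) := fun n => by
    have h1 := h.add_int_mul n 0
    have h2 := h.deriv_add_int_mul n 0
    rw [zero_add] at h1 h2
    rw [← map_smul, h1, h2, h.zero_eq]
    simp
  have ho : (fun n => v (m n * d) - ψ (m n * d) • L (1, deriv ψ 0)) =o[atTop]
      fun n => ψ (m n * d) := by
    have := hv.isLittleO.comp_tendsto hm
    refine IsLittleO.trans_isBigO (f := fun n => v (m n * d) - ψ (m n * d) • L (1, deriv ψ 0))
      (g := fun n => ψ (m n * d) • L (1, deriv ψ 0)) ?_ ?_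
    · simpa [Function.comp_def, hw] using this
    · refine IsBigO.of_bound ‖L (1, deriv ψ 0)‖ (Eventually.of_forall fun n => ?_)
      rw [norm_smul, mul_comm]
  have hi : (fun n => v (m n * d) i - ψ (m n * d) * L (1, deriv ψ 0) i) =o[atTop]
      fun n => ψ (m n * d) := (isLittleO_pi.1 ho) i
  have := hi.tendsto_div_nhds_zero.add_const (L (1, deriv ψ 0) i)
  rw [zero_add] at this
  refine this.congr fun n => ?_
  have := h.ne_zero (m n)
  field_simp
  ring

end Bloch

/-! ### Change of basis between decaying pairs at one end. -/

section Combination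

variable {A : ℝ → Matrix (Fin 4) (Fin 4) ℂ} {v w v' w' : ℝ → Fin 4 → ℂ} {l : Filter ℝ} [l.NeBot]
  {x : ℕ → ℝ} {s t : ℕ → ℂ}

theorem exists_minor_ne_zero
    (hv0 : Tendsto (fun n => v (x n) 0 / s n) atTop (𝓝 1))
    (hv2 : Tendsto (fun n => v (x n) 2 / s n) atTop (𝓝 0))
    (hw0 : Tendsto (fun n => w (x n) 0 / t n) atTop (𝓝 0))
    (hw2 : Tendsto (fun n => w (x n) 2 / t n) atTop (𝓝 1)) :
    ∃ n, v (x n) 0 * w (x n) 2 - v (x n) 2 * w (x n) 0 ≠ 0 := by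
  have h := (hv0.mul hw2).sub (hv2.mul hw0)
  have hne : (1 * 1 - 0 * 0 : ℂ) ≠ 0 := by norm_num
  obtain ⟨n, hn⟩ := (h.eventually_ne hne).exists
  refine ⟨n, fun h0 => hn ?_⟩
  rw [div_mul_div_comm, div_mul_div_comm, ← sub_div, h0, zero_div]

/-- A decaying solution is a combination of two decaying solutions that are independent at one
point, since decaying solutions span an isotropic subspace. -/
theorem IsSystemSolution.exists_eq_combination
    (hA : ∀ i j, LocallyIntegrable (fun t => A t i j) volume)
    (hsymm : ∀ x a b, wronskian ((A x).mulVec a) b + wronskian a ((A x).mulVec b) = 0)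
    (hv : IsSystemSolution A v) (hw : IsSystemSolution A w) (hv' : IsSystemSolution A v')
    (hvl : Tendsto v l (𝓝 0)) (hwl : Tendsto w l (𝓝 0)) (hvl' : Tendsto v' l (𝓝 0)) {y : ℝ}
    (hy : v y 0 * w y 2 - v y 2 * w y 0 ≠ 0) : ∃ a b : ℂ, ∀ z, v' z = a • v z + b • w z := by
  obtain ⟨a, b, hab⟩ := exists_eq_combination_of_wronskian
    (hv.wronskian_eq_zero hA hsymm hw hvl hwl y) (hv.wronskian_eq_zero hA hsymm hv' hvl hvl' y)
    (hw.wronskian_eq_zero hA hsymm hv' hwl hvl' y) hy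
  refine ⟨a, b, fun z => ?_⟩
  have := (hv'.add hA (((hv.const_smul a).add hA (hw.const_smul b)).const_smul (-1))).eq_zero hA
    (x₀ := y) (by rw [hab, neg_one_smul, add_neg_cancel]) z
  rw [neg_one_smul, ← sub_eq_add_neg] at this
  exact sub_eq_zero.1 this

/-- If `v' = a v + b w`, where `v'` and `v` are asymptotically the first unit vector times `s` and
`w` is asymptotically the second unit vector times `t` (in the components `0` and `2`), then `a = 1`
and `b t = o(s)`. -/
theorem eq_one_of_combination {f₀ f₂ g₀ g₂ h₀ h₂ : ℕ → ℂ} {a b : ℂ} (ht : ∀ n, t n ≠ 0)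
    (hf₀ : Tendsto (fun n => f₀ n / s n) atTop (𝓝 1))
    (hf₂ : Tendsto (fun n => f₂ n / s n) atTop (𝓝 0))
    (hg₀ : Tendsto (fun n => g₀ n / t n) atTop (𝓝 0))
    (hg₂ : Tendsto (fun n => g₂ n / t n) atTop (𝓝 1))
    (hh₀ : Tendsto (fun n => h₀ n / s n) atTop (𝓝 1))
    (hh₂ : Tendsto (fun n => h₂ n / s n) atTop (𝓝 0))
    (e₀ : ∀ n, h₀ n = a * f₀ n + b * g₀ n) (e₂ : ∀ n, h₂ n = a * f₂ n + b * g₂ n) :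
    a = 1 ∧ Tendsto (fun n => b * (t n / s n)) atTop (𝓝 0) := by
  have hb : Tendsto (fun n => b * (t n / s n)) atTop (𝓝 0) := by
    -- Dividing `e₂` by `s` isolates `b (t/s) (g₂/t)`, whose last factor tends to 1.
    have h1 := (hh₂.sub (hf₂.const_mul a)).div hg₂ one_ne_zero
    have hne := hg₂.eventually_ne one_ne_zero
    simp only [mul_zero, sub_zero, zero_div] at h1
    refine h1.congr' ?_
    filter_upwards [hne] with n hn
    rw [Pi.div_apply, div_eq_iff hn, e₂]
    have := ht n
    field_simp
    ring
  refine ⟨?_, hb⟩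
  have h1 := (hf₀.const_mul a).add (hb.mul hg₀)
  have h2 : Tendsto (fun n => h₀ n / s n) atTop (𝓝 (a * 1 + 0 * 0)) := by
    refine h1.congr fun n => ?_
    rw [e₀]
    have := ht n
    field_simp
  simpa using tendsto_nhds_unique h2 hh₀

theorem IsSystemSolution.exists_eq_combination_det_one
    (hA : ∀ i j, LocallyIntegrable (fun t => A t i j) volume)
    (hsymm : ∀ x a b, wronskian ((A x).mulVec a) b + wronskian a ((A x).mulVec b) = 0)
    (hv : IsSystemSolution A v) (hw : IsSystemSolution A w)
    (hv' : IsSystemSolution A v') (hw' : IsSystemSolution A w')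
    (hvl : Tendsto v l (𝓝 0)) (hwl : Tendsto w l (𝓝 0))
    (hvl' : Tendsto v' l (𝓝 0)) (hwl' : Tendsto w' l (𝓝 0))
    (hs : ∀ n, s n ≠ 0) (ht : ∀ n, t n ≠ 0)
    (hv0 : Tendsto (fun n => v (x n) 0 / s n) atTop (𝓝 1))
    (hv2 : Tendsto (fun n => v (x n) 2 / s n) atTop (𝓝 0))
    (hw0 : Tendsto (fun n => w (x n) 0 / t n) atTop (𝓝 0))
    (hw2 : Tendsto (fun n => w (x n) 2 / t n) atTop (𝓝 1))
    (hv0' : Tendsto (fun n => v' (x n) 0 / s n) atTop (𝓝 1))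
    (hv2' : Tendsto (fun n => v' (x n) 2 / s n) atTop (𝓝 0))
    (hw0' : Tendsto (fun n => w' (x n) 0 / t n) atTop (𝓝 0))
    (hw2' : Tendsto (fun n => w' (x n) 2 / t n) atTop (𝓝 1)) :
    ∃ a b : ℂ, (∀ z, v' z = v z + b • w z) ∧ (∀ z, w' z = a • v z + w z) ∧ a * b = 0 := by
  obtain ⟨n, hn⟩ := exists_minor_ne_zero hv0 hv2 hw0 hw2
  obtain ⟨p, b, hv'eq⟩ := hv.exists_eq_combination hA hsymm hw hv' hvl hwl hvl' hn
  obtain ⟨a, q, hw'eq⟩ := hv.exists_eq_combination hA hsymm hw hw' hvl hwl hwl' hn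
  obtain ⟨rfl, hb⟩ := eq_one_of_combination (a := p) (b := b) ht hv0 hv2 hw0 hw2 hv0' hv2'
    (fun n => by simp [hv'eq]) (fun n => by simp [hv'eq])
  obtain ⟨rfl, ha⟩ := eq_one_of_combination (a := q) (b := a) hs hw2 hw0 hv2 hv0 hw2' hw0'
    (fun n => by simp [hw'eq]; ring) (fun n => by simp [hw'eq]; ring)
  refine ⟨a, b, by simpa using hv'eq, by simpa using hw'eq, ?_⟩
  -- The ratios `s/t` and `t/s` cancel, so the constant `a * b` is a product of two null sequences.
  have hab : Tendsto (fun _ : ℕ => a * b) atTop (𝓝 (0 * 0)) := by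
    refine (ha.mul hb).congr fun n => ?_
    have := hs n
    have := ht n
    field_simp
  simpa using tendsto_nhds_unique tendsto_const_nhds hab

end Combination

/-! ### Independence of the Evans determinant from all choices. -/

section Frames

/-- The embedding of the phase plane of the first component. -/
def embedFst : ℂ × ℂ →ₗ[ℂ] (Fin 4 → ℂ) where
  toFun p := ![p.1, p.2, 0, 0]
  map_add' p q := by simp
  map_smul' c p := by simp

/-- The embedding of the phase plane of the second component. -/
def embedSnd : ℂ × ℂ →ₗ[ℂ] (Fin 4 → ℂ) where
  toFun p := ![0, 0, p.1, p.2]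
  map_add' p q := by simp
  map_smul' c p := by simp

variable {V : ℝ → ℝ} {d Γp Γm μs : ℝ} {φ : ℝ → ℝ} {lam : ℂ}

/-- Both ends are covered by one statement: `l` is the end, `m n * d` a sequence tending to it, and
the hypotheses on `Im k` encode decay there. -/
theorem spectral_pair_combination (hd : 0 < d) (hV : LocallyIntegrable V volume) (hφ : Continuous φ)
    {kp kp' km km' : ℂ} {ψp ψp' ψm ψm' : ℝ → ℂ} {v w v' w' : ℝ → Fin 4 → ℂ} {l : Filter ℝ}
    [l.NeBot] {m : ℕ → ℤ} (hm : Tendsto (fun n => (m n * d : ℝ)) atTop l)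
    (hkp : Tendsto (fun x => kp.im * x) l atTop) (hkp' : Tendsto (fun x => kp'.im * x) l atTop)
    (hkm : Tendsto (fun x => km.im * x) l atTop) (hkm' : Tendsto (fun x => km'.im * x) l atTop)
    (hψp : IsBlochWave V d (μs + Complex.I * lam) kp ψp)
    (hψp' : IsBlochWave V d (μs + Complex.I * lam) kp' ψp')
    (hψm : IsBlochWave V d (μs - Complex.I * lam) km ψm)
    (hψm' : IsBlochWave V d (μs - Complex.I * lam) km' ψm')
    (hv : IsSystemSolution (spectralMatrix V Γp Γm μs φ lam) v)
    (hw : IsSystemSolution (spectralMatrix V Γp Γm μs φ lam) w)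
    (hv' : IsSystemSolution (spectralMatrix V Γp Γm μs φ lam) v')
    (hw' : IsSystemSolution (spectralMatrix V Γp Γm μs φ lam) w')
    (av : v ~[l] fun x => ![ψp x, deriv ψp x, 0, 0])
    (aw : w ~[l] fun x => ![0, 0, ψm x, deriv ψm x])
    (av' : v' ~[l] fun x => ![ψp' x, deriv ψp' x, 0, 0])
    (aw' : w' ~[l] fun x => ![0, 0, ψm' x, deriv ψm' x]) :
    ∃ a b : ℂ, (∀ z, v' z = v z + b • w z) ∧ (∀ z, w' z = a • v z + w z) ∧ a * b = 0 := by
  obtain rfl := hψp.unique hV hd.ne' hψp' hkp hkp'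
  obtain rfl := hψm.unique hV hd.ne' hψm' hkm hkm'
  have hp0 : Tendsto (fun x => ![ψp x, deriv ψp x, 0, 0]) l (𝓝 0) :=
    tendsto_vec_zero (hψp.tendsto_zero hd.ne' hkp) (hψp.tendsto_deriv_zero hd.ne' hkp)
      tendsto_const_nhds tendsto_const_nhds
  have hm0 : Tendsto (fun x => ![0, 0, ψm x, deriv ψm x]) l (𝓝 0) :=
    tendsto_vec_zero tendsto_const_nhds tendsto_const_nhds
      (hψm.tendsto_zero hd.ne' hkm) (hψm.tendsto_deriv_zero hd.ne' hkm)
  exact hv.exists_eq_combination_det_one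
    (locallyIntegrable_spectralMatrix hV hφ Γp Γm μs lam) wronskian_spectralMatrix hw hv' hw'
    (av.symm.tendsto_nhds hp0) (aw.symm.tendsto_nhds hm0)
    (av'.symm.tendsto_nhds hp0) (aw'.symm.tendsto_nhds hm0)
    (fun n => hψp.ne_zero (m n)) (fun n => hψm.ne_zero (m n))
    (hψp.tendsto_div hm embedFst av 0) (hψp.tendsto_div hm embedFst av 2)
    (hψm.tendsto_div hm embedSnd aw 0) (hψm.tendsto_div hm embedSnd aw 2)
    (hψp.tendsto_div hm embedFst av' 0) (hψp.tendsto_div hm embedFst av' 2)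
    (hψm.tendsto_div hm embedSnd aw' 0) (hψm.tendsto_div hm embedSnd aw' 2)

theorem EvansFrame.det_eq_det_self (hV : LocallyIntegrable V volume) (hφ : Continuous φ)
    (F : EvansFrame V d Γp Γm μs φ lam) (x y : ℝ) : F.det x = F.det y := by
  have h {v w} (hv : IsSystemSolution (spectralMatrix V Γp Γm μs φ lam) v)
      (hw : IsSystemSolution (spectralMatrix V Γp Γm μs φ lam) w) :=
    hv.wronskian_eq (locallyIntegrable_spectralMatrix hV hφ Γp Γm μs lam)
      wronskian_spectralMatrix hw x y
  simp only [EvansFrame.det, det_eq_wronskian]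
  rw [h F.sol_vm₁ F.sol_vm₂, h F.sol_vm₁ F.sol_vp₁, h F.sol_vm₁ F.sol_vp₂,
    h F.sol_vm₂ F.sol_vp₁, h F.sol_vm₂ F.sol_vp₂, h F.sol_vp₁ F.sol_vp₂]

theorem det_combination {a b c e : ℂ} (hab : a * b = 0) (hce : c * e = 0)
    (m₁ m₂ p₁ p₂ : Fin 4 → ℂ) :
    Matrix.det (Matrix.of ![m₁ + b • m₂, a • m₁ + m₂, p₁ + e • p₂, c • p₁ + p₂]).transpose =
      Matrix.det (Matrix.of ![m₁, m₂, p₁, p₂]).transpose := by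
  have h : Matrix.det (Matrix.of ![m₁ + b • m₂, a • m₁ + m₂, p₁ + e • p₂, c • p₁ + p₂]).transpose =
      (1 - a * b) * (1 - c * e) * Matrix.det (Matrix.of ![m₁, m₂, p₁, p₂]).transpose := by
    simp only [det_eq_wronskian, wronskian, Pi.add_apply, Pi.smul_apply, smul_eq_mul]
    ring
  rw [h, hab, hce]
  ring

theorem EvansFrame.det_eq_det (hd : 0 < d) (hV : LocallyIntegrable V volume) (hφ : Continuous φ)
    (F G : EvansFrame V d Γp Γm μs φ lam) (x y : ℝ) : F.det x = G.det y := by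
  rw [F.det_eq_det_self hV hφ x y]
  have hbot : ∀ {k : ℂ}, 0 < k.im → Tendsto (fun x => (-k).im * x) atBot atTop := fun hk =>
    tendsto_id.const_mul_atBot_of_neg (by simpa using hk)
  have htop : ∀ {k : ℂ}, 0 < k.im → Tendsto (fun x => k.im * x) atTop atTop := fun hk =>
    tendsto_id.const_mul_atTop hk
  have hn : Tendsto (fun n : ℕ => (n : ℝ) * d) atTop atTop :=
    tendsto_natCast_atTop_atTop.atTop_mul_const hd
  obtain ⟨a, b, hm₁, hm₂, hab⟩ := spectral_pair_combination hd hV hφ (l := atBot)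
    (m := fun n => -(n : ℤ)) (by simpa [Function.comp_def] using hn)
    (hbot G.kp_im_pos) (hbot F.kp_im_pos) (hbot G.km_im_pos) (hbot F.km_im_pos)
    G.bloch_p₂ F.bloch_p₂ G.bloch_m₂ F.bloch_m₂ G.sol_vm₁ G.sol_vm₂ F.sol_vm₁ F.sol_vm₂
    G.asymp_vm₁ G.asymp_vm₂ F.asymp_vm₁ F.asymp_vm₂
  obtain ⟨c, e, hp₁, hp₂, hce⟩ := spectral_pair_combination hd hV hφ (l := atTop)
    (m := fun n => (n : ℤ)) (by simpa using hn)
    (htop G.kp_im_pos) (htop F.kp_im_pos) (htop G.km_im_pos) (htop F.km_im_pos)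
    G.bloch_p₁ F.bloch_p₁ G.bloch_m₁ F.bloch_m₁ G.sol_vp₁ G.sol_vp₂ F.sol_vp₁ F.sol_vp₂
    G.asymp_vp₁ G.asymp_vp₂ F.asymp_vp₁ F.asymp_vp₂
  rw [EvansFrame.det, EvansFrame.det, hm₁, hm₂, hp₁, hp₂, det_combination hab hce]

end Frames

/-! ### Conjugation symmetry. -/

section Conjugation

/-- Conjugation of all components together with the exchange of the two phase planes. -/
noncomputable def conjSwap : (Fin 4 → ℂ) →L[ℝ] (Fin 4 → ℂ) :=
  ContinuousLinearMap.pi fun i =>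
    -- Addition in `Fin 4` is modulo 4, so `i + 2` exchanges 0 with 2 and 1 with 3.
    (Complex.conjCLE : ℂ →L[ℝ] ℂ).comp (ContinuousLinearMap.proj (i + 2))

theorem conjSwap_apply (v : Fin 4 → ℂ) (i : Fin 4) :
    conjSwap v i = starRingEnd ℂ (v (i + 2)) := rfl

theorem norm_conjSwap (v : Fin 4 → ℂ) : ‖conjSwap v‖ = ‖v‖ := by
  have h : ∀ u : Fin 4 → ℂ, ‖conjSwap u‖ ≤ ‖u‖ := fun u => by
    rw [pi_norm_le_iff_of_nonneg (norm_nonneg u)]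
    intro i
    rw [conjSwap_apply, RCLike.norm_conj]
    exact norm_le_pi_norm u _
  refine le_antisymm (h v) ?_
  have hinv : conjSwap (conjSwap v) = v := by
    ext i
    fin_cases i <;> simp [conjSwap_apply]
  simpa [hinv] using h (conjSwap v)

theorem wronskian_conjSwap (v w : Fin 4 → ℂ) :
    wronskian (conjSwap v) (conjSwap w) = starRingEnd ℂ (wronskian v w) := by
  simp [wronskian, conjSwap_apply]
  ring

variable {V : ℝ → ℝ} {d Γp Γm μs : ℝ} {φ : ℝ → ℝ} {lam : ℂ}

/-- Since `V`, `φ` and `μs` are real, the conjugate of `μs + iλ` is `μs - iλ` at the conjugate of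
`λ`. -/
theorem conjSwap_mulVec_spectralMatrix (x : ℝ) (v : Fin 4 → ℂ) :
    conjSwap ((spectralMatrix V Γp Γm μs φ lam x).mulVec v) =
      (spectralMatrix V Γp Γm μs φ (starRingEnd ℂ lam) x).mulVec (conjSwap v) := by
  ext i
  rw [conjSwap_apply]
  have h2 : starRingEnd ℂ 2 = 2 := Complex.conj_ofNat 2
  fin_cases i <;>
    simp [spectralMatrix, h2, Matrix.vecHead, Matrix.vecTail, conjSwap_apply] <;> ring

theorem IsSystemSolution.conjSwap (hV : LocallyIntegrable V volume) (hφ : Continuous φ)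
    {v : ℝ → Fin 4 → ℂ} (hv : IsSystemSolution (spectralMatrix V Γp Γm μs φ lam) v) :
    IsSystemSolution (spectralMatrix V Γp Γm μs φ (starRingEnd ℂ lam))
      (fun x => _root_.conjSwap (v x)) := by
  refine ⟨_root_.conjSwap.continuous.comp hv.continuous, fun x => ?_⟩
  simp only [← conjSwap_mulVec_spectralMatrix]
  rw [ContinuousLinearMap.intervalIntegral_comp_comm _ ((locallyIntegrable_mulVec
    (locallyIntegrable_spectralMatrix hV hφ Γp Γm μs lam) hv.continuous).intervalIntegrable 0 x),
    ← map_add, ← hv.eqn x]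

theorem isEquivalent_conjSwap {l : Filter ℝ} {v w : ℝ → Fin 4 → ℂ} (h : v ~[l] w) :
    (fun x => conjSwap (v x)) ~[l] fun x => conjSwap (w x) := by
  have := h.isLittleO
  rw [← isLittleO_norm_norm] at this
  unfold IsEquivalent
  rw [← isLittleO_norm_norm]
  simpa only [Pi.sub_apply, ← map_sub, norm_conjSwap] using this

theorem conjSwap_embedFst (a b : ℂ) :
    conjSwap ![a, b, 0, 0] = ![0, 0, starRingEnd ℂ a, starRingEnd ℂ b] := by
  ext i
  fin_cases i <;> simp [conjSwap_apply]

theorem conjSwap_embedSnd (a b : ℂ) :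
    conjSwap ![0, 0, a, b] = ![starRingEnd ℂ a, starRingEnd ℂ b, 0, 0] := by
  ext i
  fin_cases i <;> simp [conjSwap_apply]

theorem deriv_conj (ψ : ℝ → ℂ) (x : ℝ) :
    deriv (fun y => starRingEnd ℂ (ψ y)) x = starRingEnd ℂ (deriv ψ x) :=
  deriv.star

/-- The conjugate of `exp (ikx)` has wave number minus the conjugate of `k`, which has the same
imaginary part. -/
theorem IsBlochWave.conj {μ k : ℂ} {ψ : ℝ → ℂ} (h : IsBlochWave V d μ k ψ) :
    IsBlochWave V d (starRingEnd ℂ μ) (-starRingEnd ℂ k) (fun x => starRingEnd ℂ (ψ x)) := by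
  refine ⟨⟨(Complex.conjCLE : ℂ →L[ℝ] ℂ).contDiff.comp h.hill.contDiff, fun x => ?_⟩, ?_⟩
  · rw [deriv_conj, deriv_conj, h.hill.eqn x, map_add, intervalIntegral, intervalIntegral, map_sub,
      ← integral_conj, ← integral_conj]
    simp
  · obtain ⟨p, hper, hp0, hp⟩ := h.bloch
    refine ⟨fun x => starRingEnd ℂ (p x), fun x => by simp [hper x], by simp [hp0], fun x => ?_⟩
    simp [hp, ← Complex.exp_conj]

/-- The frame at `conj λ` obtained by conjugation and exchange of the two components. -/
noncomputable def EvansFrame.conj (hV : LocallyIntegrable V volume) (hφ : Continuous φ)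
    (F : EvansFrame V d Γp Γm μs φ lam) : EvansFrame V d Γp Γm μs φ (starRingEnd ℂ lam) where
  kp := -starRingEnd ℂ F.km
  km := -starRingEnd ℂ F.kp
  ψp₁ x := starRingEnd ℂ (F.ψm₁ x)
  ψp₂ x := starRingEnd ℂ (F.ψm₂ x)
  ψm₁ x := starRingEnd ℂ (F.ψp₁ x)
  ψm₂ x := starRingEnd ℂ (F.ψp₂ x)
  vm₁ x := conjSwap (F.vm₂ x)
  vm₂ x := conjSwap (F.vm₁ x)
  vp₁ x := conjSwap (F.vp₂ x)
  vp₂ x := conjSwap (F.vp₁ x)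
  kp_im_pos := by simpa using F.km_im_pos
  km_im_pos := by simpa using F.kp_im_pos
  bloch_p₁ := by simpa using F.bloch_m₁.conj
  bloch_p₂ := by simpa using F.bloch_m₂.conj
  bloch_m₁ := by simpa [← sub_eq_add_neg] using F.bloch_p₁.conj
  bloch_m₂ := by simpa [← sub_eq_add_neg] using F.bloch_p₂.conj
  sol_vm₁ := F.sol_vm₂.conjSwap hV hφ
  sol_vm₂ := F.sol_vm₁.conjSwap hV hφ
  sol_vp₁ := F.sol_vp₂.conjSwap hV hφ
  sol_vp₂ := F.sol_vp₁.conjSwap hV hφ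
  asymp_vm₁ := by simpa only [deriv_conj, conjSwap_embedSnd] using isEquivalent_conjSwap F.asymp_vm₂
  asymp_vm₂ := by simpa only [deriv_conj, conjSwap_embedFst] using isEquivalent_conjSwap F.asymp_vm₁
  asymp_vp₁ := by simpa only [deriv_conj, conjSwap_embedSnd] using isEquivalent_conjSwap F.asymp_vp₂
  asymp_vp₂ := by simpa only [deriv_conj, conjSwap_embedFst] using isEquivalent_conjSwap F.asymp_vp₁

/-- Two column transpositions occur, one in each pair, so no sign remains. -/
theorem EvansFrame.det_conj (hV : LocallyIntegrable V volume) (hφ : Continuous φ)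
    (F : EvansFrame V d Γp Γm μs φ lam) (x : ℝ) :
    (F.conj hV hφ).det x = starRingEnd ℂ (F.det x) := by
  simp only [EvansFrame.det, det_eq_wronskian, EvansFrame.conj, wronskian_conjSwap, map_add,
    map_sub, map_mul]
  simp only [wronskian, map_add, map_sub, map_mul]
  ring

end Conjugation

/-! ### The Evans function. -/

theorem evansFunction_eq {V : ℝ → ℝ} {d Γp Γm μs : ℝ} {φ : ℝ → ℝ} {lam : ℂ} (hd : 0 < d)
    (hV : LocallyIntegrable V volume) (hφ : Continuous φ)
    (F : EvansFrame V d Γp Γm μs φ lam) (x xs : ℝ) :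
    F.det x = evansFunction V d Γp Γm μs φ xs lam := by
  rw [evansFunction, dif_pos ⟨F⟩]
  exact F.det_eq_det hd hV hφ _ _ _

theorem lemma3 (d : ℝ) (hd : 0 < d) (V : ℝ → ℝ) (hV : LocallyIntegrable V volume)
    (hper : Function.Periodic V d) (Γp Γm μs : ℝ) (φ : ℝ → ℝ)
    (hφ : IsGapSoliton V Γp Γm μs φ) (xs : ℝ) (lam : ℂ) :
    -- the value does not depend on the choices made, nor on the matching point
    (∀ (F : EvansFrame V d Γp Γm μs φ lam) (x : ℝ),
      F.det x = evansFunction V d Γp Γm μs φ xs lam) ∧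
    -- the domain of definition is symmetric
    (Nonempty (EvansFrame V d Γp Γm μs φ (starRingEnd ℂ lam)) ↔
      Nonempty (EvansFrame V d Γp Γm μs φ lam)) ∧
    -- the symmetry
    evansFunction V d Γp Γm μs φ xs (starRingEnd ℂ lam) =
      starRingEnd ℂ (evansFunction V d Γp Γm μs φ xs lam) := by
  have hφc := hφ.contDiff.continuous
  have hiff : Nonempty (EvansFrame V d Γp Γm μs φ (starRingEnd ℂ lam)) ↔
      Nonempty (EvansFrame V d Γp Γm μs φ lam) :=
    ⟨fun ⟨F⟩ => by simpa using Nonempty.intro (F.conj hV hφc), fun ⟨F⟩ => ⟨F.conj hV hφc⟩⟩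
  refine ⟨fun F x => evansFunction_eq hd hV hφc F x xs, hiff, ?_⟩
  by_cases h : Nonempty (EvansFrame V d Γp Γm μs φ lam)
  · obtain ⟨F⟩ := h
    rw [← evansFunction_eq hd hV hφc F xs xs, ← F.det_conj hV hφc,
      ← evansFunction_eq hd hV hφc (F.conj hV hφc) xs xs]
  -- Off the domain both sides are the default value 0, which is real.
  · rw [evansFunction, evansFunction, dif_neg h, dif_neg (hiff.not.2 h), map_zero]
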